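/- For positive integers $s_1,\dots,s_d$ with $s_1\ge 2$ let $$\zeta(s_1,\dots,s_d)=\sum_{k_1>\cdots>k_d>0}\frac{1}{k_1^{s_1}\cdots k_d^{s_d}}$$ denote the multiple zeta value, the sum being over all strictly decreasing $d$-tuples of positive integers. Then for every integer $n\ge 4$, $$\sum_{\substack{j\ge 2,\ k,l\ge 1\\ j+k+l=n}} 2^{j-1}\zeta(j,k,l)+\sum_{\substack{j\ge 2,\ k\ge 1\\ j+k=n-1}} 2^{j}\zeta(j,k,1) = n\,\zeta(n-1,1)+3\,\zeta(n-2,2)+\zeta(2,n-2)+2\,\zeta(n).$$ -/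

import Mathlib

/-- The index set of a multiple zeta series of depth `d`:
tuples `k 0 > k 1 > ⋯ > k (d - 1) > 0` of natural numbers. -/
def StrictDecPos (d : ℕ) : Type :=
  {k : Fin d → ℕ // StrictAnti k ∧ ∀ i, 0 < k i}

/-- The multiple zeta value
`ζ(s₁, …, s_d) = ∑_{k₁ > ⋯ > k_d > 0} 1 / (k₁ ^ s₁ ⋯ k_d ^ s_d)`,
where `s i` stands for `s_{i+1}`. The series converges absolutely whenever `s₁ ≥ 2` and
all `s_i ≥ 1`; see `summable_multiZeta`. -/
noncomputable def multiZeta {d : ℕ} (s : Fin d → ℕ) : ℝ :=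
  ∑' k : StrictDecPos d, 1 / ∏ i, (k.1 i : ℝ) ^ s i

/-- A product of summable nonnegative functions in separate variables is summable. -/
theorem summable_pi_prod_of_nonneg {f : ℕ → ℝ} (hf : Summable f) (h0 : ∀ n, 0 ≤ f n) (m : ℕ) :
    Summable fun k : Fin m → ℕ => ∏ i, f (k i) := by
  induction m with
  | zero => exact Summable.of_finite
  | succ m ih =>
    rw [← (Fin.consEquiv fun _ : Fin (m + 1) => ℕ).summable_iff]
    have h := hf.mul_of_nonneg ih h0 (fun k => Finset.prod_nonneg fun i _ => h0 _)
    refine h.congr fun p => ?_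
    simp [Fin.consEquiv, Fin.prod_univ_succ]

/-- Convergence of the multiple zeta series for admissible exponents. -/
theorem summable_multiZeta {d : ℕ} (s : Fin (d + 1) → ℕ) (h0 : 2 ≤ s 0) (h1 : ∀ i, 1 ≤ s i) :
    Summable fun k : StrictDecPos (d + 1) => 1 / ∏ i, (k.1 i : ℝ) ^ s i := by
  set e : ℝ := 1 / ((d : ℝ) + 1) with he
  have hd : (0 : ℝ) < (d : ℝ) + 1 := by positivity
  have hepos : 0 < e := by positivity
  have hf : Summable fun n : ℕ => ((n : ℝ) ^ (1 + e))⁻¹ :=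
    Real.summable_nat_rpow_inv.2 (by linarith)
  have hs := (summable_pi_prod_of_nonneg hf (fun n => by positivity) (d + 1)).comp_injective
    (i := fun k : StrictDecPos (d + 1) => k.1) Subtype.val_injective
  refine Summable.of_nonneg_of_le (fun k => by positivity) (fun k => ?_) hs
  obtain ⟨k, hk, hkp⟩ := k
  have hkp' : ∀ i, (0 : ℝ) < k i := fun i => by exact_mod_cast hkp i
  have hk1 : ∀ i, (1 : ℝ) ≤ k i := fun i => by exact_mod_cast hkp i
  change 1 / ∏ i, (k i : ℝ) ^ s i ≤ ∏ i, ((k i : ℝ) ^ (1 + e))⁻¹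
  rw [Finset.prod_inv_distrib, ← one_div]
  apply one_div_le_one_div_of_le (Finset.prod_pos fun i _ => Real.rpow_pos_of_pos (hkp' i) _)
  have hA : ∏ i, (k i : ℝ) ^ (1 + e) = (∏ i, (k i : ℝ)) * ∏ i, (k i : ℝ) ^ e := by
    rw [← Finset.prod_mul_distrib]
    exact Finset.prod_congr rfl fun i _ => by rw [Real.rpow_add (hkp' i), Real.rpow_one]
  have hB : ∏ i, (k i : ℝ) ^ e ≤ k 0 := by
    calc ∏ i, (k i : ℝ) ^ e ≤ ∏ _i : Fin (d + 1), (k 0 : ℝ) ^ e := by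
          refine Finset.prod_le_prod (fun i _ => by positivity) fun i _ => ?_
          have : k i ≤ k 0 := hk.antitone (Fin.zero_le i)
          gcongr
      _ = k 0 := by
          rw [Finset.prod_const, Finset.card_univ, Fintype.card_fin, ← Real.rpow_natCast,
            ← Real.rpow_mul (hkp' 0).le]
          have : e * ((d + 1 : ℕ) : ℝ) = 1 := by
            rw [he]; push_cast; field_simp
          rw [this, Real.rpow_one]
  rw [hA, Fin.prod_univ_succ, Fin.prod_univ_succ (fun i => (k i : ℝ) ^ s i)]
  have hC : ∏ i : Fin d, (k i.succ : ℝ) ≤ ∏ i : Fin d, (k i.succ : ℝ) ^ s i.succ :=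
    Finset.prod_le_prod (fun i _ => (hkp' _).le)
      fun i _ => le_self_pow₀ (hk1 _) (by have := h1 i.succ; omega)
  have hD : (k 0 : ℝ) * k 0 ≤ (k 0 : ℝ) ^ s 0 := by
    rw [← pow_two]; exact pow_le_pow_right₀ (hk1 0) h0
  have hE : (0 : ℝ) ≤ ∏ i : Fin d, (k i.succ : ℝ) := Finset.prod_nonneg fun i _ => (hkp' _).le
  calc ((k 0 : ℝ) * ∏ i : Fin d, (k i.succ : ℝ)) * ∏ i, (k i : ℝ) ^ e
      ≤ ((k 0 : ℝ) * ∏ i : Fin d, (k i.succ : ℝ)) * k 0 := by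
        have := hkp' 0
        gcongr
    _ = ((k 0 : ℝ) * k 0) * ∏ i : Fin d, (k i.succ : ℝ) := by ring
    _ ≤ _ := by gcongr

/-! The identity compares the shuffle and stuffle expansions of one product at the level of
generating series. Write g_k = 1/(k - X), t_k = 1/(k - 2X), h_k = 1/k. The product of ∑_b g_b
∑_{r<b} h_r and ∑_m g_m is truncated in two ways. Over b + m < N, partial fractions turn it into the
shuffle sum ∑ t_p g_q (g_r + 2 h_r) over N > p > q > r (`shuffle_geomSeries`). Over b, m < N it is
expanded by comparing b, r and m (`sum_mul_sum_stuffle_sub`). The pairs in between contribute a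
remainder that vanishes in the limit (`tendsto_coeff_shuffle_remainder`).

The constant term of t_p is h_p, which would produce divergent sums with leading exponent 1.
Subtracting ∑ h_p g_q (g_r + 2 h_r) from both sides removes it; `shuffle_stuffle` is the resulting
exact finite identity.

With n = c + 3, the coefficient of X^c on the left gives the weighted triple sums, the powers of 2
coming from t_p. On the right, each group is evaluated through the coefficient of (g_p - h_p) g_q,
which is (q^{-c} - p^{-c}) / (p (p - q)): sorting by the index that carries the power makes the
other sum telescope to harmonic numbers. The errors all contain a factor H_N - H_{N-m} or a similar
tail, and `tendsto_truncation_error` discards them. -/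

open Finset Filter Topology

open scoped PowerSeries

/-! ### Harmonic numbers and finite partial-fraction sums. -/

/-- The harmonic number `∑_{0 < k < n} 1 / k`. -/
noncomputable def harmonicLT (n : ℕ) : ℝ := ∑ k ∈ Ico 1 n, 1 / (k : ℝ)

theorem harmonicLT_one : harmonicLT 1 = 0 := by simp [harmonicLT]

theorem harmonicLT_succ {n : ℕ} (hn : 1 ≤ n) :
    harmonicLT (n + 1) = harmonicLT n + 1 / (n : ℝ) :=
  sum_Ico_succ_top hn _

theorem harmonicLT_mono : Monotone harmonicLT := fun _ _ h =>
  sum_le_sum_of_subset_of_nonneg (Ico_subset_Ico_right h) fun _ _ _ => by positivity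

theorem harmonicLT_nonneg (n : ℕ) : 0 ≤ harmonicLT n :=
  sum_nonneg fun _ _ => by positivity

theorem one_le_harmonicLT {n : ℕ} (hn : 2 ≤ n) : 1 ≤ harmonicLT n := by
  have h := harmonicLT_mono hn
  have h2 : harmonicLT 2 = 1 := by simp [harmonicLT]
  linarith

theorem sum_Ico_one_div {a b : ℕ} (ha : 1 ≤ a) (h : a ≤ b) :
    ∑ k ∈ Ico a b, 1 / (k : ℝ) = harmonicLT b - harmonicLT a := by
  rw [harmonicLT, harmonicLT, eq_sub_iff_add_eq', sum_Ico_consecutive _ ha h]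

theorem sum_Ico_one_div_sub {a b m : ℕ} (ha : m + 1 ≤ a) (h : a ≤ b) :
    ∑ k ∈ Ico a b, 1 / ((k : ℝ) - m) = harmonicLT (b - m) - harmonicLT (a - m) := by
  rw [← sum_Ico_one_div (by omega) (by omega)]
  obtain ⟨a, rfl⟩ := Nat.exists_eq_add_of_le' (le_of_lt (Nat.lt_of_succ_le ha))
  obtain ⟨b, rfl⟩ := Nat.exists_eq_add_of_le' (le_trans (Nat.le_add_left m a) h)
  rw [← sum_Ico_add']
  simp

theorem sum_Ico_one_div_rev {n m : ℕ} (h : m < n) :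
    ∑ i ∈ Ico 1 (m + 1), 1 / ((n : ℝ) - i) = harmonicLT n - harmonicLT (n - m) := by
  rw [← sum_Ico_one_div (by omega) (by omega)]
  have := sum_Ico_reflect (fun k : ℕ => 1 / (k : ℝ)) 1 (m := m + 1) (n := n) (by omega)
  rw [show n + 1 - (m + 1) = n - m by omega, show n + 1 - 1 = n by omega] at this
  rw [← this]
  refine sum_congr rfl fun i hi => ?_
  rw [mem_Ico] at hi
  rw [Nat.cast_sub (by omega)]

theorem sum_Ico_one_div_mul_sub {i m N : ℕ} (hi : 1 ≤ i) (him : i ≤ m) (hN : m < N) :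
    ∑ p ∈ Ico (m + 1) N, 1 / ((p : ℝ) * (p - i)) =
      1 / (i : ℝ) * (harmonicLT (m + 1) - harmonicLT (m + 1 - i)
        - (harmonicLT N - harmonicLT (N - i))) := by
  have h1 := sum_Ico_one_div_sub (a := m + 1) (b := N) (m := i) (by omega) (by omega)
  have h2 := sum_Ico_one_div (a := m + 1) (b := N) (by omega) (by omega)
  rw [show harmonicLT (m + 1) - harmonicLT (m + 1 - i) - (harmonicLT N - harmonicLT (N - i)) =
    (harmonicLT (N - i) - harmonicLT (m + 1 - i)) - (harmonicLT N - harmonicLT (m + 1)) by ring,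
    ← h1, ← h2, ← sum_sub_distrib, mul_sum]
  refine sum_congr rfl fun p hp => ?_
  rw [mem_Ico] at hp
  have hi0 : (i : ℝ) ≠ 0 := by positivity
  have hp0 : (p : ℝ) ≠ 0 := Nat.cast_ne_zero.2 (by omega)
  have hpi : (p : ℝ) - i ≠ 0 := sub_ne_zero.2 (Nat.cast_injective.ne (by omega))
  field_simp
  ring

theorem sum_Ico_one_div_sub_sub {a m N : ℕ} (ha : m + 1 ≤ a) (hN : a ≤ N) :
    ∑ p ∈ Ico a N, (1 / ((p : ℝ) - m) - 1 / p) =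
      harmonicLT a - harmonicLT (a - m) - (harmonicLT N - harmonicLT (N - m)) := by
  rw [sum_sub_distrib, sum_Ico_one_div_sub ha hN, sum_Ico_one_div (by omega) hN]
  ring

theorem sum_reflect_Ico_one {M : Type*} [AddCommMonoid M] (f : ℕ → M) (n : ℕ) :
    ∑ i ∈ Ico 1 n, f (n - i) = ∑ i ∈ Ico 1 n, f i := by
  rw [sum_Ico_reflect _ _ (by omega)]
  congr 1
  ext
  simp

/-- Summation over `a + b < n` by the value of `a + b`. -/
theorem sum_Ico_mul_sum_Ico_sub {R : Type*} [CommRing R] (f g : ℕ → R) (n : ℕ) :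
    ∑ a ∈ Ico 1 n, f a * ∑ b ∈ Ico 1 (n - a), g b =
      ∑ p ∈ Ico 1 n, ∑ a ∈ Ico 1 p, f a * g (p - a) := by
  induction n with
  | zero => simp
  | succ n ih =>
    rcases Nat.eq_zero_or_pos n with rfl | hn
    · simp
    rw [sum_Ico_succ_top hn, sum_Ico_succ_top hn, ← ih, ← sum_add_distrib]
    simp only [add_tsub_cancel_left, Ico_self, sum_empty, mul_zero, add_zero]
    refine sum_congr rfl fun a ha => ?_
    rw [mem_Ico] at ha
    rw [Nat.sub_add_comm ha.2.le, sum_Ico_succ_top (by omega), mul_add]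

/-- Grouping by a + b = p and using 1/(a (p - a)) = (1/a + 1/(p - a))/p, the left side is ∑ 2 H_p /
p, with H_p = `harmonicLT p`. This is the off-diagonal part of H_n². -/
theorem sum_one_div_mul_harmonicLT (n : ℕ) :
    ∑ i ∈ Ico 1 n, 1 / (i : ℝ) * harmonicLT (n - i) =
      harmonicLT n ^ 2 - ∑ k ∈ Ico 1 n, 1 / (k : ℝ) ^ 2 := by
  simp only [harmonicLT]
  rw [sum_Ico_mul_sum_Ico_sub (fun i => 1 / (i : ℝ)) (fun i => 1 / (i : ℝ))]
  induction n with
  | zero => simp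
  | succ n ih =>
    rcases Nat.eq_zero_or_pos n with rfl | hn
    · simp
    rw [sum_Ico_succ_top hn, ih, sum_Ico_succ_top hn, sum_Ico_succ_top hn]
    have key : ∑ a ∈ Ico 1 n, 1 / (a : ℝ) * (1 / ((n - a : ℕ) : ℝ)) =
        1 / (n : ℝ) * (∑ a ∈ Ico 1 n, 1 / (a : ℝ) + ∑ a ∈ Ico 1 n, 1 / (a : ℝ)) := by
      nth_rw 3 [← sum_reflect_Ico_one]
      rw [← sum_add_distrib, mul_sum]
      refine sum_congr rfl fun a ha => ?_
      rw [mem_Ico] at ha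
      have h1 : (a : ℝ) ≠ 0 := Nat.cast_ne_zero.2 (by omega)
      have h2 : ((n - a : ℕ) : ℝ) ≠ 0 := Nat.cast_ne_zero.2 (by omega)
      have h3 : (n : ℝ) = a + (n - a : ℕ) := by rw [Nat.cast_sub ha.2.le]; ring
      have h4 : (a : ℝ) + (n - a : ℕ) ≠ 0 := by rw [← h3]; positivity
      rw [h3]
      field_simp
      ring
    rw [key]
    have : (n : ℝ) ≠ 0 := by positivity
    field_simp
    ring

/-- Regrouping of a double sum of `(q⁻ᶜ - p⁻ᶜ) / (p (p - q))`. -/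
theorem sum_partialFraction (w : ℕ → ℕ → ℝ) (c N : ℕ) :
    ∑ p ∈ Ico 1 N, ∑ q ∈ Ico 1 p,
        1 / ((p : ℝ) * (p - q)) * (1 / (q : ℝ) ^ c - 1 / (p : ℝ) ^ c) * w p q =
      ∑ m ∈ Ico 1 N, 1 / (m : ℝ) ^ (c + 1) *
        (∑ p ∈ Ico (m + 1) N, (1 / ((p : ℝ) - m) - 1 / p) * w p m
          - ∑ q ∈ Ico 1 m, 1 / ((m : ℝ) - q) * w m q) := by
  -- The q⁻ᶜ part is grouped by its smaller index, using 1/(p (p - m)) = (1/m)(1/(p - m) - 1/p); the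
  -- p⁻ᶜ part by its larger index.
  have hL : ∑ m ∈ Ico 1 N, ∑ p ∈ Ico (m + 1) N,
        1 / ((p : ℝ) * (p - m)) * (1 / (m : ℝ) ^ c) * w p m =
      ∑ m ∈ Ico 1 N, 1 / (m : ℝ) ^ (c + 1) *
        ∑ p ∈ Ico (m + 1) N, (1 / ((p : ℝ) - m) - 1 / p) * w p m := by
    refine sum_congr rfl fun m hm => ?_
    rw [mul_sum]
    refine sum_congr rfl fun p hp => ?_
    rw [mem_Ico] at hm hp
    have hi0 : (m : ℝ) ≠ 0 := Nat.cast_ne_zero.2 (by omega)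
    have hp0 : (p : ℝ) ≠ 0 := Nat.cast_ne_zero.2 (by omega)
    have hpi : (p : ℝ) - m ≠ 0 := sub_ne_zero.2 (Nat.cast_injective.ne (by omega))
    field_simp
    ring
  have hR : ∑ m ∈ Ico 1 N, ∑ q ∈ Ico 1 m,
        1 / ((m : ℝ) * (m - q)) * (1 / (m : ℝ) ^ c) * w m q =
      ∑ m ∈ Ico 1 N, 1 / (m : ℝ) ^ (c + 1) * ∑ q ∈ Ico 1 m, 1 / ((m : ℝ) - q) * w m q := by
    refine sum_congr rfl fun m hm => ?_
    rw [mul_sum]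
    refine sum_congr rfl fun q hq => ?_
    rw [mem_Ico] at hm hq
    have hi0 : (m : ℝ) ≠ 0 := Nat.cast_ne_zero.2 (by omega)
    have hpi : (m : ℝ) - q ≠ 0 := sub_ne_zero.2 (Nat.cast_injective.ne (by omega))
    field_simp
    ring
  simp only [mul_sub (1 / (_ : ℝ) ^ (c + 1)), sum_sub_distrib (s := Ico 1 N)]
  rw [← hL, ← hR, sum_Ico_Ico_comm', ← sum_sub_distrib]
  refine sum_congr rfl fun p _ => ?_
  rw [← sum_sub_distrib]
  exact sum_congr rfl fun q _ => by ring

/-! ### Growth of harmonic numbers and negligible truncation errors. -/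

theorem harmonicLT_le_rpow {n : ℕ} (hn : 1 ≤ n) : harmonicLT n ≤ 9 * (n : ℝ) ^ (1 / 8 : ℝ) := by
  have h1 : harmonicLT n ≤ 1 + Real.log n := by
    refine le_trans (harmonicLT_mono (Nat.le_succ n)) ?_
    refine le_trans (le_of_eq ?_) (harmonic_le_one_add_log n)
    rw [harmonic_eq_sum_Icc, harmonicLT]
    push_cast
    simp only [one_div]
    rfl
  -- Any exponent below 1/3 would serve, since the cube is later divided by N. Here log n ≤ 8
  -- n^{1/8}, hence the 9 = 1 + 8.
  have h2 := Real.log_le_rpow_div (x := n) (by positivity) (ε := 1 / 8) (by norm_num)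
  have h3 : (1 : ℝ) ≤ (n : ℝ) ^ (1 / 8 : ℝ) :=
    Real.one_le_rpow (by exact_mod_cast hn) (by norm_num)
  linarith

theorem tendsto_harmonicLT_pow_div :
    Tendsto (fun N : ℕ => harmonicLT N ^ 3 / N) atTop (𝓝 0) := by
  have h : Tendsto (fun N : ℕ => 729 * (N : ℝ) ^ (-(5 / 8) : ℝ)) atTop (𝓝 0) := by
    simpa using ((tendsto_rpow_neg_atTop (y := 5 / 8) (by norm_num)).comp
      tendsto_natCast_atTop_atTop).const_mul 729
  refine squeeze_zero' (Eventually.of_forall fun N => by have := harmonicLT_nonneg N; positivity)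
    ?_ h
  filter_upwards [eventually_ge_atTop 1] with N hN
  have hN0 : (0 : ℝ) < N := by positivity
  rw [div_le_iff₀ hN0]
  calc harmonicLT N ^ 3 ≤ (9 * (N : ℝ) ^ (1 / 8 : ℝ)) ^ 3 :=
        pow_le_pow_left₀ (harmonicLT_nonneg N) (harmonicLT_le_rpow hN) 3
    _ = 729 * (N : ℝ) ^ (3 / 8 : ℝ) := by
        rw [mul_pow, ← Real.rpow_natCast, ← Real.rpow_natCast, ← Real.rpow_mul hN0.le]
        norm_num
    _ = 729 * (N : ℝ) ^ (-(5 / 8) : ℝ) * N := by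
        rw [mul_assoc, ← Real.rpow_add_one hN0.ne']
        norm_num

theorem sum_harmonicLT_sub_div_sq_le {N : ℕ} (hN : 2 ≤ N) :
    ∑ m ∈ Ico 1 N, 1 / (m : ℝ) ^ 2 * (harmonicLT N - harmonicLT (N - m)) ≤
      2 * harmonicLT N ^ 2 / N := by
  have hN0 : (0 : ℝ) < N := by positivity
  have key : ∀ m ∈ Ico 1 N, 1 / (m : ℝ) ^ 2 * (harmonicLT N - harmonicLT (N - m)) ≤
      1 / N * (1 / m + 1 / m * harmonicLT N) := by
    intro m hm
    rw [mem_Ico] at hm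
    have hm0 : (0 : ℝ) < m := by exact_mod_cast hm.1
    -- For N - m ≤ k one has N ≤ k + m, so 1/k ≤ (m/k + 1)/N; summing over the m values of k gains
    -- the factor m/N.
    have h1 : harmonicLT N - harmonicLT (N - m) ≤
        1 / N * (m * ∑ k ∈ Ico (N - m) N, 1 / (k : ℝ)) + 1 / N * m := by
      have hc : ∑ k ∈ Ico (N - m) N, (1 : ℝ) = m := by
        simp [Nat.sub_sub_self hm.2.le]
      rw [← sum_Ico_one_div (by omega) (by omega)]
      conv_rhs => rw [← mul_add]; arg 2; arg 2; rw [← hc]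
      rw [mul_sum, ← sum_add_distrib, mul_sum]
      refine sum_le_sum fun k hk => ?_
      rw [mem_Ico] at hk
      have hk0 : (0 : ℝ) < k := Nat.cast_pos.2 (by omega)
      have hkN : (N : ℝ) ≤ k + m := by exact_mod_cast (by omega : N ≤ k + m)
      rw [← sub_nonneg]
      have : 1 / (N : ℝ) * (m * (1 / k) + 1) - 1 / k = (k + m - N) / (N * k) := by
        field_simp
        ring
      rw [this]
      exact div_nonneg (by linarith) (by positivity)
    have h2 : ∑ k ∈ Ico (N - m) N, 1 / (k : ℝ) ≤ harmonicLT N := by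
      rw [sum_Ico_one_div (by omega) (by omega)]
      linarith [harmonicLT_nonneg (N - m)]
    calc 1 / (m : ℝ) ^ 2 * (harmonicLT N - harmonicLT (N - m))
        ≤ 1 / (m : ℝ) ^ 2 * (1 / N * (m * harmonicLT N) + 1 / N * m) := by
          refine mul_le_mul_of_nonneg_left (h1.trans ?_) (by positivity)
          gcongr
      _ = _ := by field_simp; ring
  refine (sum_le_sum key).trans ?_
  rw [← mul_sum, sum_add_distrib, ← sum_mul]
  change 1 / (N : ℝ) * (harmonicLT N + harmonicLT N * harmonicLT N) ≤ _
  rw [one_div, inv_mul_eq_div]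
  have := one_le_harmonicLT hN
  gcongr
  nlinarith

/-- The error terms arising from truncation are negligible. -/
theorem tendsto_truncation_error {c : ℕ} (hc : 1 ≤ c) (K : ℝ) (e : ℕ → ℕ → ℝ)
    (he : ∀ N m : ℕ, 1 ≤ m → m < N →
      |e N m| ≤ K * (harmonicLT N * (harmonicLT N - harmonicLT (N - m)))) :
    Tendsto (fun N : ℕ => ∑ m ∈ Ico 1 N, 1 / (m : ℝ) ^ (c + 1) * e N m) atTop (𝓝 0) := by
  have h : Tendsto (fun N : ℕ => 2 * |K| * (harmonicLT N ^ 3 / N)) atTop (𝓝 0) := by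
    simpa using tendsto_harmonicLT_pow_div.const_mul (2 * |K|)
  refine squeeze_zero_norm' ?_ h
  filter_upwards [eventually_ge_atTop 2] with N hN
  have hL := harmonicLT_nonneg N
  calc ‖∑ m ∈ Ico 1 N, 1 / (m : ℝ) ^ (c + 1) * e N m‖
      ≤ ∑ m ∈ Ico 1 N, |K| * harmonicLT N *
          (1 / (m : ℝ) ^ 2 * (harmonicLT N - harmonicLT (N - m))) := by
        refine norm_sum_le_of_le _ fun m hm => ?_
        rw [mem_Ico] at hm
        have hm1 : (1 : ℝ) ≤ m := by exact_mod_cast hm.1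
        have hd : 0 ≤ harmonicLT N - harmonicLT (N - m) :=
          sub_nonneg.2 (harmonicLT_mono (Nat.sub_le _ _))
        rw [norm_mul, Real.norm_eq_abs, Real.norm_eq_abs, abs_of_nonneg (by positivity)]
        calc 1 / (m : ℝ) ^ (c + 1) * |e N m|
            ≤ 1 / (m : ℝ) ^ 2 *
                (|K| * (harmonicLT N * (harmonicLT N - harmonicLT (N - m)))) := by
              refine mul_le_mul ?_ ((he N m hm.1 hm.2).trans ?_) (abs_nonneg _) (by positivity)
              · exact one_div_le_one_div_of_le (by positivity)
                  (pow_le_pow_right₀ hm1 (by omega))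
              · exact mul_le_mul_of_nonneg_right (le_abs_self K) (by positivity)
          _ = _ := by ring
    _ ≤ |K| * harmonicLT N * (2 * harmonicLT N ^ 2 / N) := by
        rw [← mul_sum]
        exact mul_le_mul_of_nonneg_left (sum_harmonicLT_sub_div_sq_le hN) (by positivity)
    _ = _ := by ring

/-! ### Truncated zeta values and limits of weighted partial-fraction sums. -/

/-- Truncation of `ζ(a)` to indices less than `N`. -/
noncomputable def partialZeta (a N : ℕ) : ℝ := ∑ k ∈ Ico 1 N, 1 / (k : ℝ) ^ a

/-- Truncation of `ζ(a, b)` to indices less than `N`. -/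
noncomputable def partialZeta₂ (a b N : ℕ) : ℝ :=
  ∑ k ∈ Ico 1 N, 1 / (k : ℝ) ^ a * partialZeta b k

/-- Truncation of `ζ(a, b, c)` to indices less than `N`. -/
noncomputable def partialZeta₃ (a b c N : ℕ) : ℝ :=
  ∑ k ∈ Ico 1 N, 1 / (k : ℝ) ^ a * partialZeta₂ b c k

theorem partialZeta_one : partialZeta 1 = harmonicLT := by
  ext n
  simp [partialZeta, harmonicLT]

theorem harmonicLT_sub_nonneg (N m : ℕ) : 0 ≤ harmonicLT N - harmonicLT (N - m) :=
  sub_nonneg.2 (harmonicLT_mono (Nat.sub_le _ _))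

/-- Both inner sums of `sum_partialFraction` telescope, leaving 1/m and the tail. The tail is kept
exactly because in `tendsto_coeff_sub_four` it becomes the main term. -/
theorem sum_partialFraction_one (c N : ℕ) :
    ∑ p ∈ Ico 1 N, ∑ q ∈ Ico 1 p,
        1 / ((p : ℝ) * (p - q)) * (1 / (q : ℝ) ^ c - 1 / (p : ℝ) ^ c) =
      partialZeta (c + 2) N
        - ∑ m ∈ Ico 1 N, 1 / (m : ℝ) ^ (c + 1) * (harmonicLT N - harmonicLT (N - m)) := by
  have h := sum_partialFraction (fun _ _ => 1) c N
  simp only [mul_one] at h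
  rw [h, partialZeta, ← sum_sub_distrib]
  refine sum_congr rfl fun m hm => ?_
  rw [mem_Ico] at hm
  have h1 := sum_Ico_one_div_rev (n := m) (m := m - 1) (by omega)
  rw [Nat.sub_add_cancel hm.1, Nat.sub_sub_self hm.1, harmonicLT_one, sub_zero] at h1
  rw [sum_Ico_one_div_sub_sub le_rfl (by omega), h1, harmonicLT_succ hm.1,
    Nat.add_sub_cancel_left, harmonicLT_one]
  have hm0 : (m : ℝ) ≠ 0 := Nat.cast_ne_zero.2 (by omega)
  field_simp
  ring

theorem tendsto_sum_partialFraction_one {c : ℕ} (hc : 1 ≤ c) :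
    Tendsto (fun N : ℕ => ∑ p ∈ Ico 1 N, ∑ q ∈ Ico 1 p,
        1 / ((p : ℝ) * (p - q)) * (1 / (q : ℝ) ^ c - 1 / (p : ℝ) ^ c)
      - partialZeta (c + 2) N) atTop (𝓝 0) := by
  refine (tendsto_truncation_error hc 1 (fun N m => -(harmonicLT N - harmonicLT (N - m)))
    fun N m hm hN => ?_).congr fun N => ?_
  · have h := harmonicLT_sub_nonneg N m
    rw [abs_neg, abs_of_nonneg h, one_mul]
    exact le_mul_of_one_le_left h (one_le_harmonicLT (by omega))
  · rw [sum_partialFraction_one]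
    simp only [mul_neg, sum_neg_distrib]
    ring

/-- For fixed m the two inner sums are H_m (H_m + 1/m), up to the tail, and H_m² - ∑_{k<m} 1/k². The
squares cancel. -/
theorem tendsto_sum_partialFraction_harmonicLT {c : ℕ} (hc : 1 ≤ c) :
    Tendsto (fun N : ℕ => ∑ p ∈ Ico 1 N, ∑ q ∈ Ico 1 p,
        1 / ((p : ℝ) * (p - q)) * (1 / (q : ℝ) ^ c - 1 / (p : ℝ) ^ c) * harmonicLT q
      - (partialZeta₂ (c + 2) 1 N + partialZeta₂ (c + 1) 2 N)) atTop (𝓝 0) := by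
  refine (tendsto_truncation_error hc 1
    (fun N m => -(harmonicLT m * (harmonicLT N - harmonicLT (N - m))))
    fun N m hm hN => ?_).congr fun N => ?_
  · have h := harmonicLT_sub_nonneg N m
    rw [abs_neg, abs_of_nonneg (mul_nonneg (harmonicLT_nonneg m) h), one_mul]
    exact mul_le_mul_of_nonneg_right (harmonicLT_mono hN.le) h
  · rw [sum_partialFraction (fun _ q => harmonicLT q) c N, partialZeta₂, partialZeta₂,
      ← sum_add_distrib, ← sum_sub_distrib, partialZeta_one]
    refine sum_congr rfl fun m hm => ?_
    rw [mem_Ico] at hm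
    have h1 : ∑ q ∈ Ico 1 m, 1 / ((m : ℝ) - q) * harmonicLT q =
        harmonicLT m ^ 2 - partialZeta 2 m := by
      rw [partialZeta, ← sum_one_div_mul_harmonicLT, ← sum_reflect_Ico_one]
      refine sum_congr rfl fun q hq => ?_
      rw [mem_Ico] at hq
      rw [Nat.cast_sub hq.2.le, sub_sub_cancel]
    rw [← sum_mul, sum_Ico_one_div_sub_sub le_rfl (by omega), h1, harmonicLT_succ hm.1,
      Nat.add_sub_cancel_left, harmonicLT_one]
    have hm0 : (m : ℝ) ≠ 0 := Nat.cast_ne_zero.2 (by omega)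
    field_simp
    ring

/-- Expanding the harmonic difference as ∑_{i≤m} 1/(k - i) and swapping sums leaves a telescoping
sum over k. -/
theorem sum_Ico_one_div_mul_harmonicLT_sub {m n N : ℕ} (hm : m ≤ n) (hN : n < N) :
    ∑ k ∈ Ico (n + 1) N, 1 / (k : ℝ) * (harmonicLT k - harmonicLT (k - m)) =
      ∑ i ∈ Ico 1 (m + 1), 1 / (i : ℝ) * (harmonicLT (n + 1) - harmonicLT (n + 1 - i)
        - (harmonicLT N - harmonicLT (N - i))) := by
  have h : ∀ k ∈ Ico (n + 1) N, 1 / (k : ℝ) * (harmonicLT k - harmonicLT (k - m)) =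
      ∑ i ∈ Ico 1 (m + 1), 1 / ((k : ℝ) * (k - i)) := by
    intro k hk
    rw [mem_Ico] at hk
    rw [← sum_Ico_one_div_rev (by omega), mul_sum]
    refine sum_congr rfl fun i _ => ?_
    rw [one_div_mul_one_div]
  rw [sum_congr rfl h, sum_comm]
  refine sum_congr rfl fun i hi => ?_
  rw [mem_Ico] at hi
  exact sum_Ico_one_div_mul_sub hi.1 (by omega) hN

theorem sum_one_div_mul_harmonicLT_sub_le {m n N : ℕ} (hmn : m ≤ n + 1) (hN : m ≤ N) :
    |∑ i ∈ Ico 1 m, 1 / (i : ℝ) * (harmonicLT N - harmonicLT (N - i))| ≤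
      harmonicLT N * (harmonicLT N - harmonicLT (N - n)) := by
  rw [abs_of_nonneg (sum_nonneg fun i _ =>
    mul_nonneg (by positivity) (harmonicLT_sub_nonneg N i))]
  refine le_trans ?_ (mul_le_mul_of_nonneg_right (harmonicLT_mono hN) (harmonicLT_sub_nonneg N n))
  rw [show harmonicLT m = ∑ i ∈ Ico 1 m, 1 / (i : ℝ) from rfl, sum_mul]
  refine sum_le_sum fun i hi => mul_le_mul_of_nonneg_left ?_ (by positivity)
  rw [mem_Ico] at hi
  have := harmonicLT_mono (show N - n ≤ N - i by omega)
  exact sub_le_sub_left this _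

/-- The weight is ∑_{q<k<p} 1/k. Performing the telescoping sum over p first leaves ∑_{k>m} 1/k²,
the source of ζ(2, c+1), and a harmonic sum that cancels the sum over q up to H_m/m and tails. -/
theorem tendsto_sum_partialFraction_harmonicLT_sub {c : ℕ} (hc : 1 ≤ c) :
    Tendsto (fun N : ℕ => ∑ p ∈ Ico 1 N, ∑ q ∈ Ico 1 p,
        1 / ((p : ℝ) * (p - q)) * (1 / (q : ℝ) ^ c - 1 / (p : ℝ) ^ c)
          * (harmonicLT p - harmonicLT (q + 1))
      - (partialZeta₂ (c + 2) 1 N + partialZeta₂ 2 (c + 1) N)) atTop (𝓝 0) := by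
  refine (tendsto_truncation_error hc 2
    (fun N m => -(harmonicLT N - harmonicLT (m + 1)) * (harmonicLT N - harmonicLT (N - m))
      - ∑ i ∈ Ico 1 m, 1 / (i : ℝ) * (harmonicLT N - harmonicLT (N - i)))
    fun N m hm hN => ?_).congr fun N => ?_
  · have h := harmonicLT_sub_nonneg N m
    have h1 := sum_one_div_mul_harmonicLT_sub_le (Nat.le_succ m) hN.le
    have h2 := harmonicLT_mono (Nat.succ_le_of_lt hN)
    have h3 := harmonicLT_nonneg (m + 1)
    have h4 : |-(harmonicLT N - harmonicLT (m + 1)) * (harmonicLT N - harmonicLT (N - m))| ≤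
        harmonicLT N * (harmonicLT N - harmonicLT (N - m)) := by
      rw [neg_mul, abs_neg, abs_of_nonneg (mul_nonneg (sub_nonneg.2 h2) h)]
      exact mul_le_mul_of_nonneg_right (by linarith) h
    exact (abs_sub _ _).trans (by linarith)
  · have hz : partialZeta₂ 2 (c + 1) N =
        ∑ m ∈ Ico 1 N, 1 / (m : ℝ) ^ (c + 1) * ∑ k ∈ Ico (m + 1) N, 1 / (k : ℝ) ^ 2 := by
      simp only [partialZeta₂, partialZeta, mul_sum]
      rw [← sum_Ico_Ico_comm']
      exact sum_congr rfl fun _ _ => sum_congr rfl fun _ _ => mul_comm _ _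
    rw [sum_partialFraction (fun p q => harmonicLT p - harmonicLT (q + 1)) c N, hz, partialZeta₂,
      ← sum_add_distrib, ← sum_sub_distrib, partialZeta_one]
    refine sum_congr rfl fun m hm => ?_
    rw [mem_Ico] at hm
    have hm0 : (m : ℝ) ≠ 0 := Nat.cast_ne_zero.2 (by omega)
    have h1 : ∑ p ∈ Ico (m + 1) N, (1 / ((p : ℝ) - m) - 1 / p)
          * (harmonicLT p - harmonicLT (m + 1)) =
        ∑ k ∈ Ico (m + 1) N, 1 / (k : ℝ) ^ 2
          + ∑ k ∈ Ico (m + 1) N, 1 / (k : ℝ) * (harmonicLT k - harmonicLT (k - (m - 1)))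
          - (harmonicLT N - harmonicLT (m + 1)) * (harmonicLT N - harmonicLT (N - m)) := by
      have h2 : ∀ p ∈ Ico (m + 1) N, (1 / ((p : ℝ) - m) - 1 / p)
            * (harmonicLT p - harmonicLT (m + 1)) =
          ∑ k ∈ Ico (m + 1) p, 1 / (k : ℝ) * (1 / ((p : ℝ) - m) - 1 / p) := by
        intro p hp
        rw [mem_Ico] at hp
        rw [← sum_Ico_one_div (by omega) hp.1, mul_comm, sum_mul]
      rw [sum_congr rfl h2, ← sum_Ico_Ico_comm', ← sum_add_distrib,
        ← sum_Ico_one_div (a := m + 1) (b := N) (by omega) (by omega), sum_mul, ← sum_sub_distrib]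
      refine sum_congr rfl fun k hk => ?_
      rw [mem_Ico] at hk
      rw [← mul_sum, sum_Ico_one_div_sub_sub (by omega) (by omega), harmonicLT_succ (by omega),
        show k + 1 - m = k - (m - 1) by omega]
      ring
    have h3 : ∑ q ∈ Ico 1 m, 1 / ((m : ℝ) - q) * (harmonicLT m - harmonicLT (q + 1)) =
        ∑ i ∈ Ico 1 m, 1 / (i : ℝ) * (harmonicLT m - harmonicLT (m + 1 - i)) := by
      rw [← sum_reflect_Ico_one]
      refine sum_congr rfl fun q hq => ?_
      rw [mem_Ico] at hq
      rw [Nat.cast_sub hq.2.le, sub_sub_cancel, Nat.sub_add_comm hq.2.le]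
    have h4 : ∑ i ∈ Ico 1 m, 1 / (i : ℝ) * (harmonicLT (m + 1) - harmonicLT (m + 1 - i)
          - (harmonicLT N - harmonicLT (N - i))) =
        ∑ i ∈ Ico 1 m, 1 / (i : ℝ) * (harmonicLT m - harmonicLT (m + 1 - i))
          + 1 / m * harmonicLT m
          - ∑ i ∈ Ico 1 m, 1 / (i : ℝ) * (harmonicLT N - harmonicLT (N - i)) := by
      rw [harmonicLT_succ hm.1]
      rw [show 1 / (m : ℝ) * harmonicLT m = ∑ i ∈ Ico 1 m, 1 / (m : ℝ) * (1 / i) from mul_sum _ _ _,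
         ← sum_add_distrib, ← sum_sub_distrib]
      exact sum_congr rfl fun i _ => by ring
    rw [h1, h3, sum_Ico_one_div_mul_harmonicLT_sub (by omega) hm.2, Nat.sub_add_cancel hm.1, h4]
    field_simp
    ring

/-- After swapping, the sum over p > m tends to ∑_{i≤m} (H_{m+1} - H_{m+1-i})/i, which equals
∑_{k≤m} 1/k² by `sum_one_div_mul_harmonicLT`. The terms k < m and k = m give the two zeta values. -/
theorem tendsto_sum_harmonicLT_sub {c : ℕ} (hc : 1 ≤ c) :
    Tendsto (fun N : ℕ => ∑ p ∈ Ico 1 N, 1 / (p : ℝ) * ∑ m ∈ Ico 1 p,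
        1 / (m : ℝ) ^ (c + 1) * (harmonicLT p - harmonicLT (p - m))
      - (partialZeta₂ (c + 1) 2 N + partialZeta (c + 3) N)) atTop (𝓝 0) := by
  refine (tendsto_truncation_error hc 1
    (fun N m => -∑ i ∈ Ico 1 (m + 1), 1 / (i : ℝ) * (harmonicLT N - harmonicLT (N - i)))
    fun N m hm hN => ?_).congr fun N => ?_
  · rw [abs_neg, one_mul]
    exact sum_one_div_mul_harmonicLT_sub_le le_rfl hN
  · have h : ∑ p ∈ Ico 1 N, 1 / (p : ℝ) * ∑ m ∈ Ico 1 p,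
        1 / (m : ℝ) ^ (c + 1) * (harmonicLT p - harmonicLT (p - m)) =
        ∑ m ∈ Ico 1 N, 1 / (m : ℝ) ^ (c + 1) *
          ∑ p ∈ Ico (m + 1) N, 1 / (p : ℝ) * (harmonicLT p - harmonicLT (p - m)) := by
      simp only [mul_sum]
      rw [sum_Ico_Ico_comm']
      exact sum_congr rfl fun _ _ => sum_congr rfl fun _ _ => by ring
    rw [h, partialZeta₂, partialZeta, ← sum_add_distrib, ← sum_sub_distrib]
    refine sum_congr rfl fun m hm => ?_
    rw [mem_Ico] at hm
    have hm0 : (m : ℝ) ≠ 0 := Nat.cast_ne_zero.2 (by omega)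
    have h1 : ∑ i ∈ Ico 1 (m + 1), 1 / (i : ℝ) * (harmonicLT (m + 1) - harmonicLT (m + 1 - i)
          - (harmonicLT N - harmonicLT (N - i))) =
        partialZeta 2 m + 1 / (m : ℝ) ^ 2
          - ∑ i ∈ Ico 1 (m + 1), 1 / (i : ℝ) * (harmonicLT N - harmonicLT (N - i)) := by
      have h2 := sum_one_div_mul_harmonicLT (m + 1)
      rw [sum_Ico_succ_top hm.1 (fun k => 1 / (k : ℝ) ^ 2)] at h2
      have h3 : ∑ i ∈ Ico 1 (m + 1), 1 / (i : ℝ) * harmonicLT (m + 1) = harmonicLT (m + 1) ^ 2 := by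
        rw [← sum_mul, sq]
        rfl
      simp only [mul_sub, sum_sub_distrib] at h2 h3 ⊢
      rw [partialZeta]
      linarith
    rw [sum_Ico_one_div_mul_harmonicLT_sub le_rfl hm.2, h1]
    field_simp
    ring

/-! ### Generating series and their shuffle and stuffle products. -/

/-- The power series `1 / (k - X)`. -/
noncomputable def geomSeries (k : ℕ) : ℝ⟦X⟧ := PowerSeries.mk fun i => 1 / (k : ℝ) ^ (i + 1)

/-- The power series `1 / (k - 2 X)`. -/
noncomputable def geomSeriesTwo (k : ℕ) : ℝ⟦X⟧ := PowerSeries.mk fun i => 2 ^ i / (k : ℝ) ^ (i + 1)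

/-- The constant power series `1 / k`. -/
noncomputable def constInv (k : ℕ) : ℝ⟦X⟧ := PowerSeries.C (1 / (k : ℝ))

theorem natCast_eq_C (k : ℕ) : (k : ℝ⟦X⟧) = PowerSeries.C (k : ℝ) := by simp

theorem constInv_mul {k : ℕ} (hk : k ≠ 0) : constInv k * (k : ℝ⟦X⟧) = 1 := by
  have : (k : ℝ) ≠ 0 := Nat.cast_ne_zero.2 hk
  rw [constInv, natCast_eq_C, ← map_mul, one_div_mul_cancel this, map_one]

theorem geomSeries_mul {k : ℕ} (hk : k ≠ 0) :
    geomSeries k * ((k : ℝ⟦X⟧) - PowerSeries.X) = 1 := by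
  have : (k : ℝ) ≠ 0 := Nat.cast_ne_zero.2 hk
  ext i
  rw [mul_sub, map_sub, natCast_eq_C, PowerSeries.coeff_mul_C, geomSeries]
  cases i with
  | zero => simp [this]
  | succ i =>
    rw [PowerSeries.coeff_succ_mul_X]
    simp only [PowerSeries.coeff_mk, PowerSeries.coeff_one]
    simp
    field_simp
    ring

theorem geomSeriesTwo_mul {k : ℕ} (hk : k ≠ 0) :
    geomSeriesTwo k * ((k : ℝ⟦X⟧) - 2 * PowerSeries.X) = 1 := by
  have : (k : ℝ) ≠ 0 := Nat.cast_ne_zero.2 hk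
  have h2 : (2 : ℝ⟦X⟧) = PowerSeries.C 2 := (map_ofNat PowerSeries.C 2).symm
  ext i
  rw [mul_sub, map_sub, natCast_eq_C, PowerSeries.coeff_mul_C, mul_left_comm, h2,
    PowerSeries.coeff_C_mul, geomSeriesTwo]
  cases i with
  | zero => simp [this]
  | succ i =>
    rw [PowerSeries.coeff_succ_mul_X]
    simp only [PowerSeries.coeff_mk, PowerSeries.coeff_one]
    simp
    field_simp
    ring

/-- Partial fractions from (m - X) + (n - X) = (m + n) - 2X: this is where the powers of 2
originate. -/
theorem geomSeries_mul_geomSeries {m n : ℕ} (hm : m ≠ 0) (hn : n ≠ 0) :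
    geomSeries m * geomSeries n = geomSeriesTwo (m + n) * (geomSeries m + geomSeries n) := by
  have h1 := geomSeries_mul hm
  have h2 := geomSeries_mul hn
  have h3 := geomSeriesTwo_mul (k := m + n) (by omega)
  push_cast at h3
  linear_combination -(geomSeries m * geomSeries n) * h3
    + geomSeriesTwo (m + n) * geomSeries n * h1 + geomSeriesTwo (m + n) * geomSeries m * h2

theorem geomSeries_mul_constInv {m n : ℕ} (hm : m ≠ 0) (hn : n ≠ 0) :
    geomSeries m * constInv n = geomSeries (m + n) * (geomSeries m + constInv n) := by
  have h1 := geomSeries_mul hm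
  have h2 := constInv_mul hn
  have h3 := geomSeries_mul (k := m + n) (by omega)
  push_cast at h3
  linear_combination -(geomSeries m * constInv n) * h3
    + geomSeries (m + n) * constInv n * h1 + geomSeries (m + n) * geomSeries m * h2

/-- Shuffle product of a single and a double sum. -/
theorem shuffle_geomSeries (N : ℕ) :
    ∑ b ∈ Ico 1 N, geomSeries b * (∑ r ∈ Ico 1 b, constInv r) * ∑ m ∈ Ico 1 (N - b), geomSeries m =
      ∑ p ∈ Ico 1 N, geomSeriesTwo p * ∑ q ∈ Ico 1 p, geomSeries q *
        ∑ r ∈ Ico 1 q, (geomSeries r + 2 * constInv r) := by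
  rw [sum_Ico_mul_sum_Ico_sub]
  refine sum_congr rfl fun p _ => ?_
  have h1 : ∀ a ∈ Ico 1 p,
      geomSeries a * (∑ r ∈ Ico 1 a, constInv r) * geomSeries (p - a) =
      geomSeriesTwo p * (geomSeries a * ∑ r ∈ Ico 1 a, constInv r
        + geomSeries (p - a) * ∑ r ∈ Ico 1 a, constInv r) := by
    intro a ha
    rw [mem_Ico] at ha
    have := geomSeries_mul_geomSeries (m := a) (n := p - a) (by omega) (by omega)
    rw [Nat.add_sub_cancel' ha.2.le] at this
    linear_combination (∑ r ∈ Ico 1 a, constInv r) * this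
  -- When the single factor supplies the middle index, its g must still be shuffled with h_r; this
  -- second shuffle yields g_r + h_r.
  have h2 : ∑ a ∈ Ico 1 p, geomSeries (p - a) * ∑ r ∈ Ico 1 a, constInv r =
      ∑ q ∈ Ico 1 p, geomSeries q * ∑ r ∈ Ico 1 q, (geomSeries r + constInv r) := by
    rw [← sum_reflect_Ico_one]
    have h3 : ∀ a ∈ Ico 1 p, geomSeries (p - (p - a)) * ∑ r ∈ Ico 1 (p - a), constInv r =
        geomSeries a * ∑ r ∈ Ico 1 (p - a), constInv r := by
      intro a ha
      rw [mem_Ico] at ha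
      rw [Nat.sub_sub_self ha.2.le]
    rw [sum_congr rfl h3, sum_Ico_mul_sum_Ico_sub]
    refine sum_congr rfl fun q _ => ?_
    rw [sum_add_distrib, ← sum_reflect_Ico_one constInv, ← sum_add_distrib, mul_sum]
    refine sum_congr rfl fun a ha => ?_
    rw [mem_Ico] at ha
    rw [geomSeries_mul_constInv (by omega) (by omega), Nat.add_sub_cancel' ha.2.le]
  rw [sum_congr rfl h1, ← mul_sum, sum_add_distrib, h2, ← sum_add_distrib]
  congr 1
  refine sum_congr rfl fun q _ => ?_
  rw [← mul_add, ← sum_add_distrib]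
  congr 1
  exact sum_congr rfl fun r _ => by ring

/-- Stuffle product of two single sums. -/
theorem sum_mul_sum_stuffle {R : Type*} [CommRing R] (g h : ℕ → R) (N : ℕ) :
    (∑ k ∈ Ico 1 N, g k) * ∑ k ∈ Ico 1 N, h k =
      ∑ p ∈ Ico 1 N, g p * ∑ q ∈ Ico 1 p, h q + ∑ p ∈ Ico 1 N, h p * ∑ q ∈ Ico 1 p, g q
        + ∑ p ∈ Ico 1 N, h p * g p := by
  induction N with
  | zero => simp
  | succ n ih =>
    rcases Nat.eq_zero_or_pos n with rfl | hn
    · simp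
    simp only [sum_Ico_succ_top hn]
    linear_combination ih

/-- Stuffle product of a single and a double sum, regrouped into convergent parts. -/
theorem sum_mul_sum_stuffle_sub {R : Type*} [CommRing R] (g h : ℕ → R) (N : ℕ) :
    (∑ b ∈ Ico 1 N, g b * ∑ r ∈ Ico 1 b, h r) * (∑ m ∈ Ico 1 N, g m)
        - ∑ p ∈ Ico 1 N, h p * ∑ q ∈ Ico 1 p, g q * ∑ r ∈ Ico 1 q, (g r + 2 * h r) =
      2 * ∑ p ∈ Ico 1 N, (g p - h p) * ∑ q ∈ Ico 1 p, g q * ∑ r ∈ Ico 1 q, h r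
      + ∑ p ∈ Ico 1 N, (g p - h p) * ∑ q ∈ Ico 1 p, h q * ∑ r ∈ Ico 1 q, g r
      + ∑ p ∈ Ico 1 N, g p * g p * ∑ q ∈ Ico 1 p, h q
      + ∑ p ∈ Ico 1 N, (g p - h p) * ∑ q ∈ Ico 1 p, h q * g q
      + ∑ p ∈ Ico 1 N, h p * ∑ q ∈ Ico 1 p, (h q * g q - (g q - h q) * ∑ r ∈ Ico 1 q, g r) := by
  induction N with
  | zero => simp
  | succ n ih =>
    rcases Nat.eq_zero_or_pos n with rfl | hn
    · simp
    simp only [sum_Ico_succ_top hn]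
    have h1 := sum_mul_sum_stuffle g h n
    simp only [sum_sub_distrib, sum_add_distrib, mul_add, sub_mul, ← mul_sum,
      mul_left_comm _ (2 : R)] at ih h1 ⊢
    -- Raising N adds g_n (∑ g)(∑ h) to the product, hence one use of the depth-one stuffle.
    linear_combination ih + g n * h1

/-- Every b, m < N satisfies either b + m < N, the shuffle range, or m ≥ N - b, the last sum. -/
theorem shuffle_stuffle (N : ℕ) :
    ∑ p ∈ Ico 1 N, (geomSeriesTwo p - constInv p) * ∑ q ∈ Ico 1 p, geomSeries q *
        ∑ r ∈ Ico 1 q, (geomSeries r + 2 * constInv r) =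
      2 * ∑ p ∈ Ico 1 N, (geomSeries p - constInv p) *
        ∑ q ∈ Ico 1 p, geomSeries q * ∑ r ∈ Ico 1 q, constInv r
      + ∑ p ∈ Ico 1 N, (geomSeries p - constInv p) *
        ∑ q ∈ Ico 1 p, constInv q * ∑ r ∈ Ico 1 q, geomSeries r
      + ∑ p ∈ Ico 1 N, geomSeries p * geomSeries p * ∑ q ∈ Ico 1 p, constInv q
      + ∑ p ∈ Ico 1 N, (geomSeries p - constInv p) * ∑ q ∈ Ico 1 p, constInv q * geomSeries q
      + ∑ p ∈ Ico 1 N, constInv p * ∑ q ∈ Ico 1 p,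
        (constInv q * geomSeries q - (geomSeries q - constInv q) * ∑ r ∈ Ico 1 q, geomSeries r)
      - ∑ b ∈ Ico 1 N, geomSeries b * (∑ r ∈ Ico 1 b, constInv r) *
        ∑ m ∈ Ico (N - b) N, geomSeries m := by
  rw [← sum_mul_sum_stuffle_sub]
  have h : ∀ b ∈ Ico 1 N, geomSeries b * (∑ r ∈ Ico 1 b, constInv r) *
        ∑ m ∈ Ico (N - b) N, geomSeries m =
      geomSeries b * (∑ r ∈ Ico 1 b, constInv r) * ∑ m ∈ Ico 1 N, geomSeries m
      - geomSeries b * (∑ r ∈ Ico 1 b, constInv r) * ∑ m ∈ Ico 1 (N - b), geomSeries m := by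
    intro b hb
    rw [mem_Ico] at hb
    rw [← sum_Ico_consecutive geomSeries (m := 1) (n := N - b) (k := N) (by omega) (by omega)]
    ring
  rw [sum_congr rfl h, sum_sub_distrib, shuffle_geomSeries, ← sum_mul]
  simp only [sub_mul (geomSeriesTwo _), sum_sub_distrib]
  ring

/-! ### Coefficients of the stuffle side and their limits. -/

theorem coeff_geomSeries (i k : ℕ) :
    PowerSeries.coeff i (geomSeries k) = 1 / (k : ℝ) ^ (i + 1) := by
  rw [geomSeries, PowerSeries.coeff_mk]

theorem sum_constInv {a b : ℕ} (ha : 1 ≤ a) (h : a ≤ b) :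
    ∑ k ∈ Ico a b, constInv k = PowerSeries.C (harmonicLT b - harmonicLT a) := by
  simp only [constInv]
  rw [← map_sum, sum_Ico_one_div ha h]

theorem sum_constInv_Ico_one (b : ℕ) :
    ∑ k ∈ Ico 1 b, constInv k = PowerSeries.C (harmonicLT b) := by
  simp only [constInv]
  rw [← map_sum, harmonicLT]

theorem constInv_mul_geomSeries {k : ℕ} (hk : k ≠ 0) :
    PowerSeries.X * (constInv k * geomSeries k) = geomSeries k - constInv k := by
  linear_combination geomSeries k * constInv_mul hk - constInv k * geomSeries_mul hk

/-- Since g_p - h_p = X h_p g_p and (p - q) g_p g_q = g_q - g_p, multiplying by p (p - q) gives X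
(g_q - g_p). -/
theorem coeff_geomSeries_sub_mul {p q c : ℕ} (hq : 1 ≤ q) (hqp : q < p) (hc : 1 ≤ c) :
    PowerSeries.coeff c ((geomSeries p - constInv p) * geomSeries q) =
      1 / ((p : ℝ) * (p - q)) * (1 / (q : ℝ) ^ c - 1 / (p : ℝ) ^ c) := by
  obtain ⟨c, rfl⟩ := Nat.exists_eq_add_of_le' hc
  have hp0 : (p : ℝ) ≠ 0 := Nat.cast_ne_zero.2 (by omega)
  have hpq : (p : ℝ) - q ≠ 0 := sub_ne_zero.2 (Nat.cast_injective.ne (by omega))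
  have h : PowerSeries.C ((p : ℝ) * (p - q)) * ((geomSeries p - constInv p) * geomSeries q) =
      (geomSeries q - geomSeries p) * PowerSeries.X := by
    have h1 := geomSeries_mul (k := p) (by omega)
    have h2 := geomSeries_mul (k := q) (by omega)
    have h3 := constInv_mul (k := p) (by omega)
    rw [map_mul, map_sub, ← natCast_eq_C, ← natCast_eq_C,
      ← constInv_mul_geomSeries (k := p) (by omega)]
    linear_combination PowerSeries.X * ((p : ℝ⟦X⟧) - q) * geomSeries p * geomSeries q * h3
      + PowerSeries.X * geomSeries q * h1 - PowerSeries.X * geomSeries p * h2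
  have h4 := congrArg (PowerSeries.coeff (c + 1)) h
  rw [PowerSeries.coeff_C_mul, PowerSeries.coeff_succ_mul_X, map_sub, coeff_geomSeries,
    coeff_geomSeries] at h4
  rw [← h4]
  field_simp

theorem coeff_geomSeries_sub {p c : ℕ} (hc : 1 ≤ c) :
    PowerSeries.coeff c (geomSeries p - constInv p) = 1 / (p : ℝ) ^ (c + 1) := by
  rw [map_sub, coeff_geomSeries, constInv, PowerSeries.coeff_C, if_neg (by omega), sub_zero]

theorem coeff_constInv_mul_geomSeries {q : ℕ} (c : ℕ) (hq : 1 ≤ q) :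
    PowerSeries.coeff c (constInv q * geomSeries q) = 1 / (q : ℝ) ^ (c + 2) := by
  have hq0 : (q : ℝ) ≠ 0 := Nat.cast_ne_zero.2 (by omega)
  rw [constInv, PowerSeries.coeff_C_mul, coeff_geomSeries]
  field_simp
  ring

theorem tendsto_coeff_sub_one {c : ℕ} (hc : 1 ≤ c) :
    Tendsto (fun N : ℕ => PowerSeries.coeff c (∑ p ∈ Ico 1 N, (geomSeries p - constInv p) *
        ∑ q ∈ Ico 1 p, geomSeries q * ∑ r ∈ Ico 1 q, constInv r)
      - (partialZeta₂ (c + 2) 1 N + partialZeta₂ (c + 1) 2 N)) atTop (𝓝 0) := by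
  refine (tendsto_sum_partialFraction_harmonicLT hc).congr fun N => ?_
  congr 1
  simp only [mul_sum (Ico 1 _) _ (_ - constInv _), map_sum]
  refine sum_congr rfl fun p hp => sum_congr rfl fun q hq => ?_
  rw [mem_Ico] at hp hq
  rw [sum_constInv_Ico_one, ← mul_assoc, PowerSeries.coeff_mul_C,
    coeff_geomSeries_sub_mul hq.1 hq.2 hc]

theorem tendsto_coeff_sub_two {c : ℕ} (hc : 1 ≤ c) :
    Tendsto (fun N : ℕ => PowerSeries.coeff c (∑ p ∈ Ico 1 N, (geomSeries p - constInv p) *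
        ∑ q ∈ Ico 1 p, constInv q * ∑ r ∈ Ico 1 q, geomSeries r)
      - (partialZeta₂ (c + 2) 1 N + partialZeta₂ 2 (c + 1) N)) atTop (𝓝 0) := by
  refine (tendsto_sum_partialFraction_harmonicLT_sub hc).congr fun N => ?_
  congr 1
  rw [map_sum]
  refine sum_congr rfl fun p hp => ?_
  simp only [mul_sum (Ico 1 _) _ (constInv _)]
  rw [← sum_Ico_Ico_comm', mul_sum, map_sum]
  refine sum_congr rfl fun q hq => ?_
  rw [mem_Ico] at hp hq
  rw [← sum_mul, sum_constInv (by omega) (by omega), mul_left_comm,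
    PowerSeries.coeff_C_mul, coeff_geomSeries_sub_mul hq.1 hq.2 hc, mul_comm]

theorem coeff_sum_geomSeries_sq (c N : ℕ) :
    PowerSeries.coeff c (∑ p ∈ Ico 1 N, geomSeries p * geomSeries p * ∑ q ∈ Ico 1 p, constInv q) =
      (c + 1) * partialZeta₂ (c + 2) 1 N := by
  rw [map_sum, partialZeta₂, mul_sum, partialZeta_one]
  refine sum_congr rfl fun p hp => ?_
  rw [sum_constInv_Ico_one, PowerSeries.coeff_mul_C, PowerSeries.coeff_mul]
  have h : ∀ x ∈ antidiagonal c, PowerSeries.coeff x.1 (geomSeries p) *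
      PowerSeries.coeff x.2 (geomSeries p) = 1 / (p : ℝ) ^ (c + 2) := by
    intro x hx
    rw [HasAntidiagonal.mem_antidiagonal] at hx
    rw [coeff_geomSeries, coeff_geomSeries, one_div_mul_one_div, ← pow_add, ← hx]
    congr 2
    ring
  rw [sum_congr rfl h, sum_const, Nat.card_antidiagonal, nsmul_eq_mul]
  push_cast
  ring

/-- As X h_q g_q = g_q - h_q, the X^c coefficient is the X^{c+1} coefficient of (g_p - h_p)(g_q -
h_q). The g_q part gives ζ(c+3), the h_q part ζ(c+2, 1). -/
theorem tendsto_coeff_sub_three (c : ℕ) :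
    Tendsto (fun N : ℕ => PowerSeries.coeff c (∑ p ∈ Ico 1 N, (geomSeries p - constInv p) *
        ∑ q ∈ Ico 1 p, constInv q * geomSeries q)
      - (partialZeta (c + 3) N - partialZeta₂ (c + 2) 1 N)) atTop (𝓝 0) := by
  refine (tendsto_sum_partialFraction_one (c := c + 1) (by omega)).congr fun N => ?_
  rw [← sub_add, sub_add_eq_add_sub]
  congr 1
  rw [partialZeta₂, map_sum, ← sum_add_distrib]
  refine sum_congr rfl fun p hp => ?_
  rw [partialZeta_one, harmonicLT, mul_sum, mul_sum, map_sum, ← sum_add_distrib]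
  refine sum_congr rfl fun q hq => ?_
  rw [mem_Ico] at hp hq
  have h1 := PowerSeries.coeff_succ_X_mul c
    ((geomSeries p - constInv p) * (constInv q * geomSeries q))
  rw [mul_left_comm, constInv_mul_geomSeries (by omega), mul_sub, map_sub,
    coeff_geomSeries_sub_mul hq.1 hq.2 (by omega)] at h1
  nth_rw 2 [constInv] at h1
  rw [PowerSeries.coeff_mul_C, coeff_geomSeries_sub (by omega)] at h1
  rw [← h1]
  ring

/-- By `sum_partialFraction_one` the zeta parts of the sum over q < p cancel, so the outer weight
1/p meets only the small tail. -/
theorem tendsto_coeff_sub_four {c : ℕ} (hc : 1 ≤ c) :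
    Tendsto (fun N : ℕ => PowerSeries.coeff c (∑ p ∈ Ico 1 N, constInv p * ∑ q ∈ Ico 1 p,
        (constInv q * geomSeries q - (geomSeries q - constInv q) * ∑ r ∈ Ico 1 q, geomSeries r))
      - (partialZeta₂ (c + 1) 2 N + partialZeta (c + 3) N)) atTop (𝓝 0) := by
  refine (tendsto_sum_harmonicLT_sub hc).congr fun N => ?_
  congr 1
  rw [map_sum]
  refine sum_congr rfl fun p _ => ?_
  rw [constInv, PowerSeries.coeff_C_mul, sum_sub_distrib, map_sub, map_sum, map_sum]
  congr 1
  have h := sum_partialFraction_one c p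
  have h1 : ∑ q ∈ Ico 1 p, PowerSeries.coeff c
        ((geomSeries q - constInv q) * ∑ r ∈ Ico 1 q, geomSeries r) =
      ∑ q ∈ Ico 1 p, ∑ r ∈ Ico 1 q,
        1 / ((q : ℝ) * (q - r)) * (1 / (r : ℝ) ^ c - 1 / (q : ℝ) ^ c) := by
    refine sum_congr rfl fun q _ => ?_
    rw [mul_sum, map_sum]
    refine sum_congr rfl fun r hr => ?_
    rw [mem_Ico] at hr
    exact coeff_geomSeries_sub_mul hr.1 hr.2 hc
  have h2 : ∑ q ∈ Ico 1 p, PowerSeries.coeff c (constInv q * geomSeries q) =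
      partialZeta (c + 2) p :=
    sum_congr rfl fun q hq => coeff_constInv_mul_geomSeries c (mem_Ico.1 hq).1
  rw [h1, h2, h]
  ring

/-- Since c ≥ 1, in each term of the Cauchy product b or m carries an exponent at least 2. The sum
over the other index is a tail starting at N minus that index. -/
theorem tendsto_coeff_shuffle_remainder {c : ℕ} (hc : 1 ≤ c) :
    Tendsto (fun N : ℕ => PowerSeries.coeff c (∑ b ∈ Ico 1 N,
      geomSeries b * (∑ r ∈ Ico 1 b, constInv r) * ∑ m ∈ Ico (N - b) N, geomSeries m))
      atTop (𝓝 0) := by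
  have key : ∀ x ∈ antidiagonal c, Tendsto (fun N : ℕ => ∑ b ∈ Ico 1 N, ∑ m ∈ Ico (N - b) N,
      1 / (b : ℝ) ^ (x.1 + 1) * harmonicLT b * (1 / (m : ℝ) ^ (x.2 + 1))) atTop (𝓝 0) := by
    intro x hx
    rw [HasAntidiagonal.mem_antidiagonal] at hx
    have hle : ∀ k : ℕ, 1 ≤ k → ∀ i : ℕ, 1 / (k : ℝ) ^ (i + 1) ≤ 1 / k := by
      intro k hk i
      have hk1 : (1 : ℝ) ≤ k := by exact_mod_cast hk
      exact one_div_le_one_div_of_le (by positivity) (le_self_pow₀ hk1 (by omega))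
    rcases Nat.eq_zero_or_pos x.1 with h0 | h0
    · refine (tendsto_truncation_error (c := x.2) (by omega) 1 (fun N m => ∑ b ∈ Ico (N - m) N,
        1 / (b : ℝ) ^ (x.1 + 1) * harmonicLT b) fun N m hm hN => ?_).congr fun N => ?_
      · rw [abs_of_nonneg (sum_nonneg fun b _ =>
          mul_nonneg (by positivity) (harmonicLT_nonneg b)), one_mul, mul_comm,
          ← sum_Ico_one_div (by omega) (by omega), sum_mul]
        refine sum_le_sum fun b hb => ?_
        rw [mem_Ico] at hb
        exact mul_le_mul (hle b (by omega) _) (harmonicLT_mono hb.2.le) (harmonicLT_nonneg b)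
          (by positivity)
      · rw [sum_comm' (t' := Ico 1 N) (s' := fun m => Ico (N - m) N)]
        · refine sum_congr rfl fun m _ => ?_
          rw [← sum_mul, mul_comm]
        · intro b m
          simp only [mem_Ico]
          omega
    · refine (tendsto_truncation_error (c := x.1) h0 1 (fun N b => harmonicLT b *
        ∑ m ∈ Ico (N - b) N, 1 / (m : ℝ) ^ (x.2 + 1)) fun N b hb hN => ?_).congr fun N => ?_
      · have hs : 0 ≤ ∑ m ∈ Ico (N - b) N, 1 / (m : ℝ) ^ (x.2 + 1) :=
          sum_nonneg fun m _ => by positivity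
        rw [abs_of_nonneg (mul_nonneg (harmonicLT_nonneg b) hs), one_mul,
          ← sum_Ico_one_div (by omega) (by omega)]
        refine mul_le_mul (harmonicLT_mono hN.le) (sum_le_sum fun m hm => ?_) hs
          (harmonicLT_nonneg N)
        rw [mem_Ico] at hm
        exact hle m (by omega) _
      · refine sum_congr rfl fun b _ => ?_
        rw [← mul_sum]
        ring
  have h := tendsto_finsetSum (antidiagonal c) key
  rw [sum_const_zero] at h
  refine h.congr fun N => ?_
  rw [map_sum, sum_comm]
  refine sum_congr rfl fun b _ => ?_
  rw [mul_right_comm, sum_constInv_Ico_one, PowerSeries.coeff_mul_C, PowerSeries.coeff_mul, sum_mul]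
  refine sum_congr rfl fun x _ => ?_
  rw [coeff_geomSeries, map_sum, mul_sum, sum_mul]
  refine sum_congr rfl fun m _ => ?_
  rw [coeff_geomSeries]
  ring

/-! ### Convergence of truncated sums to multiple zeta values. -/

open Classical in
/-- Strictly decreasing positive `d`-tuples with entries less than `N`. -/
noncomputable def decTuples (d N : ℕ) : Finset (Fin d → ℕ) := 
  (Fintype.piFinset fun _ : Fin d => range N).filter fun k => StrictAnti k ∧ ∀ i, 0 < k i

theorem mem_decTuples {d N : ℕ} {k : Fin d → ℕ} :
    k ∈ decTuples d N ↔ (∀ i, k i < N) ∧ StrictAnti k ∧ ∀ i, 0 < k i := by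
  simp [decTuples]

theorem cons_mem_decTuples {d N p : ℕ} {k : Fin d → ℕ} :
    (Fin.cons p k : Fin (d + 1) → ℕ) ∈ decTuples (d + 1) N ↔
      p ∈ Ico 1 N ∧ k ∈ decTuples d p := by
  simp only [mem_decTuples, Fin.forall_fin_succ, Fin.cons_zero, Fin.cons_succ, mem_Ico]
  constructor
  · rintro ⟨⟨h1, h2⟩, h3, h4, h5⟩
    refine ⟨⟨h4, h1⟩, fun i => ?_, fun i j hij => ?_, h5⟩
    · simpa using h3 (Fin.succ_pos i)
    · simpa using h3 (Fin.succ_lt_succ_iff.2 hij)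
  · rintro ⟨⟨h1, h2⟩, h3, h4, h5⟩
    refine ⟨⟨h2, fun i => (h3 i).trans h2⟩, fun i j hij => ?_, h1, h5⟩
    obtain ⟨j, rfl⟩ := Fin.exists_succ_eq.2 (Fin.ne_zero_of_lt hij)
    induction i using Fin.cases with
    | zero => simpa using h3 j
    | succ i => simpa using h4 (Fin.succ_lt_succ_iff.1 hij)

theorem sum_decTuples_succ {d : ℕ} (N : ℕ) (F : (Fin (d + 1) → ℕ) → ℝ) :
    ∑ k ∈ decTuples (d + 1) N, F k = ∑ p ∈ Ico 1 N, ∑ k ∈ decTuples d p, F (Fin.cons p k) := by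
  rw [sum_sigma']
  refine sum_bij' (fun k _ => ⟨k 0, Fin.tail k⟩) (fun x _ => Fin.cons x.1 x.2) ?_ ?_ ?_ ?_ ?_
  · intro k hk
    rw [← Fin.cons_self_tail k, cons_mem_decTuples] at hk
    simpa using hk
  · intro x hx
    rw [mem_sigma] at hx
    exact cons_mem_decTuples.2 hx
  · intro k _
    simp
  · intro x _
    simp
  · intro k _
    simp

theorem decTuples_zero (N : ℕ) : decTuples 0 N = {![]} := by
  ext k
  rw [mem_decTuples, mem_singleton]
  exact ⟨fun _ => Subsingleton.elim _ _,
    fun _ => ⟨fun i => i.elim0, fun i => i.elim0, fun i => i.elim0⟩⟩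

theorem tendsto_sum_decTuples {d : ℕ} (s : Fin (d + 1) → ℕ) (h0 : 2 ≤ s 0) (h1 : ∀ i, 1 ≤ s i) :
    Tendsto (fun N => ∑ k ∈ decTuples (d + 1) N, 1 / ∏ i, (k i : ℝ) ^ s i) atTop
      (𝓝 (multiZeta s)) := by
  classical
  have hs : HasSum ((fun k : Fin (d + 1) → ℕ => 1 / ∏ i, (k i : ℝ) ^ s i) ∘
      ((↑) : {k : Fin (d + 1) → ℕ | StrictAnti k ∧ ∀ i, 0 < k i} → _)) (multiZeta s) :=
    (summable_multiZeta s h0 h1).hasSum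
  -- Extending by zero to all tuples lets the cubes `range N` be used as a cofinal family of finite
  -- sets.
  rw [hasSum_subtype_iff_indicator] at hs
  have ht : Tendsto (fun N : ℕ => Fintype.piFinset fun _ : Fin (d + 1) => range N) atTop atTop := by
    refine tendsto_atTop_finset_of_monotone (fun M N h => ?_) fun k => ?_
    · exact Fintype.piFinset_subset _ _ fun _ => range_subset_range.2 h
    · refine ⟨univ.sup k + 1, Fintype.mem_piFinset.2 fun i => mem_range.2 ?_⟩
      exact Nat.lt_succ_of_le (le_sup (mem_univ i))
  refine (hs.comp ht).congr fun N => ?_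
  simp only [Function.comp, decTuples, sum_filter]
  refine sum_congr rfl fun k _ => ?_
  simp [Set.indicator_apply]

theorem tendsto_partialZeta {a : ℕ} (ha : 2 ≤ a) :
    Tendsto (partialZeta a) atTop (𝓝 (multiZeta ![a])) := by
  refine (tendsto_sum_decTuples ![a] ha fun i => ?_).congr fun N => ?_
  · fin_cases i; simp; omega
  · simp [sum_decTuples_succ, decTuples_zero, partialZeta]

theorem tendsto_partialZeta₂ {a b : ℕ} (ha : 2 ≤ a) (hb : 1 ≤ b) :
    Tendsto (partialZeta₂ a b) atTop (𝓝 (multiZeta ![a, b])) := by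
  refine (tendsto_sum_decTuples ![a, b] ha fun i => ?_).congr fun N => ?_
  · fin_cases i <;> simp <;> omega
  · simp [sum_decTuples_succ, decTuples_zero, partialZeta, partialZeta₂, Fin.prod_univ_succ,
      mul_sum, mul_comm]

theorem tendsto_partialZeta₃ {a b c : ℕ} (ha : 2 ≤ a) (hb : 1 ≤ b) (hc : 1 ≤ c) :
    Tendsto (partialZeta₃ a b c) atTop (𝓝 (multiZeta ![a, b, c])) := by
  refine (tendsto_sum_decTuples ![a, b, c] ha fun i => ?_).congr fun N => ?_
  · fin_cases i <;> simp <;> omega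
  · simp [sum_decTuples_succ, decTuples_zero, partialZeta, partialZeta₂, partialZeta₃,
      Fin.prod_univ_succ, mul_sum, mul_comm, mul_left_comm]

/-! ### Coefficients of the shuffle side and reindexing of exponents. -/

theorem coeff_geomSeriesTwo_sub (i p : ℕ) :
    PowerSeries.coeff i (geomSeriesTwo p - constInv p) =
      if 1 ≤ i then 2 ^ i * (1 / (p : ℝ) ^ (i + 1)) else 0 := by
  rw [map_sub, geomSeriesTwo, constInv, PowerSeries.coeff_mk, PowerSeries.coeff_C]
  rcases Nat.eq_zero_or_pos i with rfl | hi
  · simp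
  · rw [if_neg hi.ne', if_pos (show 1 ≤ i from hi), sub_zero, mul_one_div]

theorem coeff_sum_geomSeriesTwo_one (c N : ℕ) :
    PowerSeries.coeff c (∑ p ∈ Ico 1 N, (geomSeriesTwo p - constInv p) *
        ∑ q ∈ Ico 1 p, geomSeries q * ∑ r ∈ Ico 1 q, geomSeries r) =
      ∑ x ∈ (HasAntidiagonal.antidiagonal c).filter (fun x => 1 ≤ x.1),
        ∑ y ∈ HasAntidiagonal.antidiagonal x.2,
          2 ^ x.1 * partialZeta₃ (x.1 + 1) (y.1 + 1) (y.2 + 1) N := by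
  have h1 : ∀ i q : ℕ, PowerSeries.coeff i (∑ r ∈ Ico 1 q, geomSeries r) =
      partialZeta (i + 1) q := by
    intro i q
    simp only [map_sum, coeff_geomSeries, partialZeta]
  have h2 : ∀ i p : ℕ, PowerSeries.coeff i
      (∑ q ∈ Ico 1 p, geomSeries q * ∑ r ∈ Ico 1 q, geomSeries r) =
      ∑ y ∈ HasAntidiagonal.antidiagonal i, partialZeta₂ (y.1 + 1) (y.2 + 1) p := by
    intro i p
    rw [map_sum]
    simp only [PowerSeries.coeff_mul, h1, coeff_geomSeries, partialZeta₂]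
    exact sum_comm
  rw [map_sum, sum_filter]
  simp only [PowerSeries.coeff_mul, h2, coeff_geomSeriesTwo_sub]
  rw [sum_comm]
  refine sum_congr rfl fun x _ => ?_
  split_ifs
  · simp only [partialZeta₃, mul_sum]
    rw [sum_comm]
    exact sum_congr rfl fun _ _ => sum_congr rfl fun _ _ => by ring
  · simp

theorem coeff_sum_geomSeriesTwo_two (c N : ℕ) :
    PowerSeries.coeff c (∑ p ∈ Ico 1 N, (geomSeriesTwo p - constInv p) *
        ∑ q ∈ Ico 1 p, geomSeries q * ∑ r ∈ Ico 1 q, constInv r) =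
      ∑ x ∈ (HasAntidiagonal.antidiagonal c).filter (fun x => 1 ≤ x.1),
        2 ^ x.1 * partialZeta₃ (x.1 + 1) (x.2 + 1) 1 N := by
  have h2 : ∀ i p : ℕ, PowerSeries.coeff i
      (∑ q ∈ Ico 1 p, geomSeries q * ∑ r ∈ Ico 1 q, constInv r) = partialZeta₂ (i + 1) 1 p := by
    intro i p
    simp only [map_sum, sum_constInv_Ico_one, PowerSeries.coeff_mul_C, coeff_geomSeries,
      partialZeta₂, partialZeta_one]
  rw [map_sum, sum_filter]
  simp only [PowerSeries.coeff_mul, h2, coeff_geomSeriesTwo_sub]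
  rw [sum_comm]
  refine sum_congr rfl fun x _ => ?_
  split_ifs
  · simp only [partialZeta₃, mul_sum]
    exact sum_congr rfl fun _ _ => by ring
  · simp

theorem sum_antidiagonalTuple_three (c : ℕ) (f : ℕ → ℕ → ℕ → ℝ) :
    ∑ s ∈ (Finset.Nat.antidiagonalTuple 3 (c + 3)).filter
        (fun s => 2 ≤ s 0 ∧ 1 ≤ s 1 ∧ 1 ≤ s 2), f (s 0) (s 1) (s 2) =
      ∑ x ∈ (HasAntidiagonal.antidiagonal c).filter (fun x => 1 ≤ x.1),
        ∑ y ∈ HasAntidiagonal.antidiagonal x.2, f (x.1 + 1) (y.1 + 1) (y.2 + 1) := by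
  rw [sum_sigma']
  refine sum_bij' (fun s _ => ⟨(s 0 - 1, s 1 - 1 + (s 2 - 1)), (s 1 - 1, s 2 - 1)⟩)
    (fun x _ => ![x.1.1 + 1, x.2.1 + 1, x.2.2 + 1]) ?_ ?_ ?_ ?_ ?_
  · intro s hs
    simp only [mem_filter, Finset.Nat.mem_antidiagonalTuple, Fin.sum_univ_three] at hs
    simp only [mem_sigma, mem_filter, HasAntidiagonal.mem_antidiagonal, and_true]
    omega
  · rintro ⟨⟨a, b⟩, ⟨d, e⟩⟩ hx
    simp only [mem_sigma, mem_filter, HasAntidiagonal.mem_antidiagonal] at hx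
    simp [Finset.Nat.mem_antidiagonalTuple, Fin.sum_univ_three]
    omega
  · intro s hs
    simp only [mem_filter] at hs
    ext i
    fin_cases i <;> simp <;> omega
  · rintro ⟨⟨a, b⟩, ⟨d, e⟩⟩ hx
    simp only [mem_sigma, mem_filter, HasAntidiagonal.mem_antidiagonal] at hx
    obtain ⟨_, rfl⟩ := hx
    simp
  · intro s hs
    simp only [mem_filter] at hs
    simp only [Nat.sub_add_cancel hs.2.2.1, Nat.sub_add_cancel hs.2.2.2,
      Nat.sub_add_cancel (one_le_two.trans hs.2.1)]

theorem sum_antidiagonal_two (c : ℕ) (f : ℕ → ℕ → ℝ) :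
    ∑ p ∈ (HasAntidiagonal.antidiagonal (c + 2)).filter (fun p => 2 ≤ p.1 ∧ 1 ≤ p.2), f p.1 p.2 =
      ∑ x ∈ (HasAntidiagonal.antidiagonal c).filter (fun x => 1 ≤ x.1),
        f (x.1 + 1) (x.2 + 1) := by
  refine sum_bij' (fun s _ => (s.1 - 1, s.2 - 1)) (fun x _ => (x.1 + 1, x.2 + 1)) ?_ ?_ ?_ ?_ ?_
  · intro s hs
    simp only [mem_filter, HasAntidiagonal.mem_antidiagonal] at hs ⊢
    omega
  · intro s hs
    simp only [mem_filter, HasAntidiagonal.mem_antidiagonal] at hs ⊢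
    omega
  · rintro ⟨a, b⟩ hs
    simp only [mem_filter] at hs
    ext <;> simp <;> omega
  · intro s _
    simp
  · intro s hs
    simp only [mem_filter] at hs
    simp only [Nat.sub_add_cancel hs.2.2, Nat.sub_add_cancel (one_le_two.trans hs.2.1)]

/-! ### Passage to the limit. -/

theorem mainTheorem2 (n : ℕ) (hn : 4 ≤ n) :
    (∑ s ∈ (Finset.Nat.antidiagonalTuple 3 n).filter
        (fun s => 2 ≤ s 0 ∧ 1 ≤ s 1 ∧ 1 ≤ s 2),
      (2 : ℝ) ^ (s 0 - 1) * multiZeta ![s 0, s 1, s 2])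
    + (∑ p ∈ (Finset.HasAntidiagonal.antidiagonal (n - 1)).filter (fun p => 2 ≤ p.1 ∧ 1 ≤ p.2),
      (2 : ℝ) ^ p.1 * multiZeta ![p.1, p.2, 1])
    = (n : ℝ) * multiZeta ![n - 1, 1] + 3 * multiZeta ![n - 2, 2]
      + multiZeta ![2, n - 2] + 2 * multiZeta ![n] := by
  obtain ⟨c, rfl⟩ := Nat.exists_eq_add_of_le' (show 3 ≤ n by omega)
  have hc : 1 ≤ c := by omega
  rw [sum_antidiagonalTuple_three c (fun i j k => (2 : ℝ) ^ (i - 1) * multiZeta ![i, j, k]),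
    show c + 3 - 1 = c + 2 by omega, show c + 3 - 2 = c + 1 by omega,
    sum_antidiagonal_two c (fun i j => (2 : ℝ) ^ i * multiZeta ![i, j, 1])]
  simp only [Nat.add_sub_cancel]
  have hl1 : Tendsto (fun N => ∑ x ∈ (HasAntidiagonal.antidiagonal c).filter (fun x => 1 ≤ x.1),
      ∑ y ∈ HasAntidiagonal.antidiagonal x.2,
        (2 : ℝ) ^ x.1 * partialZeta₃ (x.1 + 1) (y.1 + 1) (y.2 + 1) N) atTop
      (𝓝 (∑ x ∈ (HasAntidiagonal.antidiagonal c).filter (fun x => 1 ≤ x.1),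
      ∑ y ∈ HasAntidiagonal.antidiagonal x.2,
        (2 : ℝ) ^ x.1 * multiZeta ![x.1 + 1, y.1 + 1, y.2 + 1])) := by
    refine tendsto_finsetSum _ fun x hx => tendsto_finsetSum _ fun y _ => ?_
    rw [mem_filter] at hx
    exact (tendsto_partialZeta₃ (by omega) (by omega) (by omega)).const_mul _
  have hl2 : Tendsto (fun N => ∑ x ∈ (HasAntidiagonal.antidiagonal c).filter (fun x => 1 ≤ x.1),
        (2 : ℝ) ^ x.1 * partialZeta₃ (x.1 + 1) (x.2 + 1) 1 N) atTop
      (𝓝 (∑ x ∈ (HasAntidiagonal.antidiagonal c).filter (fun x => 1 ≤ x.1),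
        (2 : ℝ) ^ x.1 * multiZeta ![x.1 + 1, x.2 + 1, 1])) := by
    refine tendsto_finsetSum _ fun x hx => ?_
    rw [mem_filter] at hx
    exact (tendsto_partialZeta₃ (by omega) (by omega) le_rfl).const_mul _
  have hz1 := tendsto_partialZeta₂ (a := c + 2) (b := 1) (by omega) le_rfl
  have hz2 := tendsto_partialZeta₂ (a := c + 1) (b := 2) (by omega) (by omega)
  have hz3 := tendsto_partialZeta₂ (a := 2) (b := c + 1) le_rfl (by omega)
  have hz4 := tendsto_partialZeta (a := c + 3) (by omega)
  have herr := ((((tendsto_coeff_sub_one hc).const_mul 2).add (tendsto_coeff_sub_two hc)).add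
    (tendsto_coeff_sub_three c)).add (tendsto_coeff_sub_four hc) |>.sub
    (tendsto_coeff_shuffle_remainder hc)
  -- Tally of the five stuffle groups: ζ(c+2, 1) occurs 2 + 1 + (c + 1) - 1 = c + 3 times, ζ(c+1, 2)
  -- 2 + 1 times, ζ(2, c+1) once, ζ(c+3) 1 + 1 times.
  have hr := (((hz1.const_mul ((c : ℝ) + 3)).add (hz2.const_mul 3)).add hz3).add
    (hz4.const_mul 2) |>.add herr
  have heq : ∑ x ∈ (HasAntidiagonal.antidiagonal c).filter (fun x => 1 ≤ x.1),
        (2 : ℝ) ^ (x.1 + 1) * multiZeta ![x.1 + 1, x.2 + 1, 1] =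
      2 * ∑ x ∈ (HasAntidiagonal.antidiagonal c).filter (fun x => 1 ≤ x.1),
        (2 : ℝ) ^ x.1 * multiZeta ![x.1 + 1, x.2 + 1, 1] := by
    rw [mul_sum]
    exact sum_congr rfl fun x _ => by ring
  rw [heq]
  refine (tendsto_nhds_unique (hl1.add (hl2.const_mul 2)) (hr.congr fun N => ?_)).trans ?_
  · have h := congrArg (PowerSeries.coeff c) (shuffle_stuffle N)
    have h2 : ∀ f : ℝ⟦X⟧, PowerSeries.coeff c (2 * f) = 2 * PowerSeries.coeff c f := fun f => by
      rw [two_mul, map_add, two_mul]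
    have h3 : ∑ p ∈ Ico 1 N, (geomSeriesTwo p - constInv p) * ∑ q ∈ Ico 1 p, geomSeries q *
          ∑ r ∈ Ico 1 q, (geomSeries r + 2 * constInv r) =
        ∑ p ∈ Ico 1 N, (geomSeriesTwo p - constInv p) *
          ∑ q ∈ Ico 1 p, geomSeries q * ∑ r ∈ Ico 1 q, geomSeries r
        + 2 * ∑ p ∈ Ico 1 N, (geomSeriesTwo p - constInv p) *
          ∑ q ∈ Ico 1 p, geomSeries q * ∑ r ∈ Ico 1 q, constInv r := by
      simp only [sum_add_distrib, mul_add, ← mul_sum, mul_left_comm _ (2 : ℝ⟦X⟧)]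
    rw [h3] at h
    simp only [map_add, map_sub, h2] at h
    rw [coeff_sum_geomSeriesTwo_one, coeff_sum_geomSeriesTwo_two, coeff_sum_geomSeries_sq] at h
    rw [h]
    ring
  · push_cast
    ring
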